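/- Let $G$ be a connected (finite-dimensional, real) Lie group with Lie algebra $\mathfrak g$, centre $Z(G)$ and adjoint representation ${\rm Ad}:G\to {\rm GL}(\mathfrak g)$. A *(left) brace* $(\mathfrak g,+,*)$ is a group structure $*$ on the set $\mathfrak g$ such that $x*(y+z)=x*y+x*z-x$ for all $x,y,z$, where $+$ is the vector addition; its *gamma function* is $\gamma(x)y=-x+x*y$. A *Rota-Baxter operator of weight $0$* on $G$ means here a map $\mathcal B:\mathfrak g\to G$, not necessarily smooth, with $\mathcal B(x)\mathcal B(y)=\mathcal B(x+{\rm Ad}_{\mathcal B(x)}y)$ for all $x,y\in\mathfrak g$ (that is, a relative Rota-Baxter operator of weight $0$ with respect to the adjoint action). It yields the brace $(\mathfrak g,+,*_{\mathcal B})$ with $x*_{\mathcal B}y=x+{\rm Ad}_{\mathcal B(x)}y$. Let $(\mathfrak g,+,*)$ be a brace whose gamma function takes values in ${\rm Ad}_G$, and let $C:\mathfrak g\to G$ be any function with $\gamma(x)={\rm Ad}_{C(x)}$ for all $x\in\mathfrak g$. Put $\kappa(x,y)=C(x)C(y)C(x*y)^{-1}$. For $\lambda:\mathfrak g\to Z(G)$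 put $\delta(\lambda)(x,y)=\lambda(y)\lambda(x*y)^{-1}\lambda(x)$. Cohomology below is that of abstract groups. (i) $\kappa$ takes values in $Z(G)$ and is a $2$-cocycle of $(\mathfrak g,*)$ with coefficients in the trivial module $Z(G)$, that is, $\kappa(y,z)\kappa(x*y,z)^{-1}\kappa(x,y*z)\kappa(x,y)^{-1}=1$ for all $x,y,z$. Its class in $H^2((\mathfrak g,*),Z(G))$ does not depend on the choice of $C$. (ii) There is a Rota-Baxter operator $\mathcal B$ of weight $0$ on $G$ with $*_{\mathcal B}=*$ if and only if the class of $\kappa$ in $H^2((\mathfrak g,*),Z(G))$ is trivial. In this situation, whenever $\kappa=\delta(\lambda)$ with $\lambda:\mathfrak g\to Z(G)$, the map $\mathcal B(x)=C(x)\lambda(x)^{-1}$ is a Rota-Baxter operator of weight $0$ with $*_{\mathcal B}=*$, and every Rota-Baxter operator of weight $0$ that yields the brace is of this form. Moreover, the brace comes from a smooth Rota-Baxter operator of weight $0$ if and only if $\kappa=\delta(\lambda)$ for some $\lambda:\mathfrak g\to Z(G)$ such that $x\mapsto C(x)\lambda(x)^{-1}$ is smooth. (iii) Two Rota-Baxter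 operators $\mathcal B,\mathcal B'$ of weight $0$ on $G$ yield the same brace if and only if there is a group homomorphism $\xi:(\mathfrak g,*_{\mathcal B'})\to Z(G)$ such that $\mathcal B(x)=\mathcal B'(x)\xi(x)$ for all $x\in\mathfrak g$. -/

import Mathlib

open scoped Manifold ContDiff

/-- A (left) brace structure on an abelian group `(V, +)`: a second group structure `∗` on `V`
with `x ∗ (y + z) = x ∗ y + x ∗ z - x`. -/
structure Brace (V : Type*) [AddCommGroup V] extends Group V where
  mul_add_eq : ∀ x y z : V, x * (y + z) = x * y + x * z - x

namespace Brace

variable {V : Type*} [AddCommGroup V]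

/-- The multiplication `x ∗ y` of a brace. -/
def op (b : Brace V) (x y : V) : V := b.toGroup.mul x y

/-- The gamma function of a brace, `γ(x) y = -x + x ∗ y`. -/
def gamma (b : Brace V) (x y : V) : V := -x + b.op x y

end Brace

section GroupCohomology

variable (Γ A : Type*) [Group Γ] [CommGroup A]

/-- The (inhomogeneous) `2`-cocycles of a group `Γ` with values in an abelian group `A`, written
multiplicatively and regarded as a trivial `Γ`-module. -/
def trivCocycles₂ : Subgroup (Γ → Γ → A) where
  carrier := {k | ∀ x y z, k y z * (k (x * y) z)⁻¹ * k x (y * z) * (k x y)⁻¹ = 1}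
  one_mem' := by intro x y z; simp
  mul_mem' := by
    intro a b ha hb x y z
    have h := congrArg₂ (· * ·) (ha x y z) (hb x y z)
    simp only [mul_one] at h
    rw [← h]
    simp only [Pi.mul_apply, mul_inv]
    ac_rfl
  inv_mem' := by
    intro a ha x y z
    have h := congrArg (·⁻¹) (ha x y z)
    simp only [inv_one] at h
    rw [← h]
    simp only [Pi.inv_apply, mul_inv]

/-- The coboundary `δ(l)(x, y) = l(y) l(xy)⁻¹ l(x)` of a `1`-cochain `l : Γ → A`. -/
def trivDelta : (Γ → A) →* (Γ → Γ → A) where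
  toFun l x y := l y * (l (x * y))⁻¹ * l x
  map_one' := by funext x y; simp
  map_mul' := by
    intro a b
    funext x y
    simp only [Pi.mul_apply, mul_inv]
    ac_rfl

/-- The second cohomology group `H²(Γ, A)` with trivial action: `2`-cocycles modulo
`2`-coboundaries. -/
abbrev TrivH2 : Type _ := trivCocycles₂ Γ A ⧸ (trivDelta Γ A).range.subgroupOf (trivCocycles₂ Γ A)

variable {Γ A}

/-- The cohomology class of a `2`-cocycle. -/
def trivClass (k : trivCocycles₂ Γ A) : TrivH2 Γ A := QuotientGroup.mk k

end GroupCohomology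

namespace Brace

variable {V : Type*} [AddCommGroup V] (b : Brace V) (A : Type*) [CommGroup A]

/-- The `2`-cocycles of `(V, ∗)` with values in the trivial `(V, ∗)`-module `A`. -/
abbrev cocycles₂ : Subgroup (V → V → A) := @trivCocycles₂ V A b.toGroup _

/-- The coboundary map from `1`-cochains to `2`-cochains of `(V, ∗)`. -/
abbrev delta : (V → A) →* (V → V → A) := @trivDelta V A b.toGroup _

/-- The cohomology group `H²((V, ∗), A)`. -/
abbrev H2 : Type _ := @TrivH2 V A b.toGroup _

variable {A}

/-- The class in `H²((V, ∗), A)` of a `2`-cocycle. -/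
abbrev cohomologyClass (k : b.cocycles₂ A) : b.H2 A := @trivClass V A b.toGroup _ k

end Brace

/-- The center `Z(G)` is an abelian group. -/
instance centerCommGroup {G : Type*} [Group G] : CommGroup (Subgroup.center G) :=
  { (inferInstance : Group (Subgroup.center G)) with
    mul_comm := fun a b => Subtype.ext (Subgroup.mem_center_iff.mp b.2 a) }

section LieGroups

variable {E : Type*} [NormedAddCommGroup E] [NormedSpace ℝ E] {H : Type*} [TopologicalSpace H]
  (I : ModelWithCorners ℝ E H) {G : Type*} [TopologicalSpace G] [ChartedSpace H G] [Group G]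

/-- The differential at `1` of the conjugation `h ↦ g h g⁻¹`. -/
noncomputable def adMap (g : G) : GroupLieAlgebra I G →L[ℝ] GroupLieAlgebra I G :=
  (mfderiv I I (fun h : G => g * h * g⁻¹) 1 : _)

theorem adMap_one : adMap I (1 : G) = 1 := by
  have h : (fun h : G => (1 : G) * h * (1 : G)⁻¹) = id := by funext h; simp
  unfold adMap
  rw [h]
  exact mfderiv_id

variable [LieGroup I ∞ G]

theorem mdifferentiableAt_conj (g k : G) :
    MDifferentiableAt I I (fun h : G => g * h * g⁻¹) k := by
  have h1 : ContMDiff I I ∞ (fun h : G => g * h * g⁻¹) :=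
    (contMDiff_const.mul contMDiff_id).mul contMDiff_const
  exact h1.contMDiffAt.mdifferentiableAt (by simp)

theorem adMap_mul (g k : G) : adMap I (g * k) = adMap I g * adMap I k := by
  have h : (fun h : G => (g * k) * h * (g * k)⁻¹) =
      (fun h : G => g * h * g⁻¹) ∘ (fun h : G => k * h * k⁻¹) := by
    funext h; simp [mul_assoc]
  have e : k * 1 * k⁻¹ = 1 := by simp
  have h2 := mfderiv_comp (I := I) (I' := I) (I'' := I) (1 : G)
    (mdifferentiableAt_conj I g (k * 1 * k⁻¹)) (mdifferentiableAt_conj I k 1)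
  unfold adMap
  rw [h, h2, e]
  rfl

/-- The adjoint representation of a Lie group on its Lie algebra. -/
noncomputable def Ad : G →* (GroupLieAlgebra I G →L[ℝ] GroupLieAlgebra I G) where
  toFun := adMap I
  map_one' := adMap_one I
  map_mul' := adMap_mul I

/-- `B : 𝔤 → G` satisfies the Rota-Baxter identity of weight `0`,
`B(x) B(y) = B(x + Ad_{B(x)} y)`; that is, `B` is a relative Rota-Baxter operator of weight `0` on
`G` with respect to the adjoint action. No smoothness is included. -/
def IsRotaBaxter (B : GroupLieAlgebra I G → G) : Prop :=
  ∀ x y, B x * B y = B (x + Ad I (B x) y)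

/-- `B : 𝔤 → G` is smooth, the Lie algebra `𝔤` being a copy of the model vector space `E`. -/
def IsSmoothOnLieAlgebra (B : GroupLieAlgebra I G → G) : Prop :=
  ContMDiff 𝓘(ℝ, E) I ∞ (fun x : E => B x)

variable {I}

theorem Ad_inv_apply (g : G) (x : GroupLieAlgebra I G) : Ad I g⁻¹ (Ad I g x) = x := by
  have h : Ad I g⁻¹ * Ad I g = 1 := by rw [← map_mul]; simp
  exact DFunLike.congr_fun h x

theorem Ad_apply_inv (g : G) (x : GroupLieAlgebra I G) : Ad I g (Ad I g⁻¹ x) = x := by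
  have h : Ad I g * Ad I g⁻¹ = 1 := by rw [← map_mul]; simp
  exact DFunLike.congr_fun h x

theorem Ad_mul_apply (g k : G) (x : GroupLieAlgebra I G) :
    Ad I (g * k) x = Ad I g (Ad I k x) := by
  rw [map_mul]; rfl

theorem IsRotaBaxter.map_zero {B : GroupLieAlgebra I G → G} (hB : IsRotaBaxter I B) :
    B 0 = 1 := by
  have h := hB 0 0
  rw [ContinuousLinearMap.map_zero, add_zero] at h
  simpa using h

theorem IsRotaBaxter.map_inv {B : GroupLieAlgebra I G → G} (hB : IsRotaBaxter I B)
    (x : GroupLieAlgebra I G) : B (-(Ad I (B x)⁻¹ x)) = (B x)⁻¹ := by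
  have h := hB x (-(Ad I (B x)⁻¹ x))
  rw [ContinuousLinearMap.map_neg, Ad_apply_inv, add_neg_cancel, hB.map_zero] at h
  exact (inv_eq_of_mul_eq_one_right h).symm

/-- The brace `(𝔤, +, ∗)` with `x ∗ y = x + Ad_{B(x)} y` that a Rota-Baxter operator `B` of
weight `0` yields. -/
noncomputable def IsRotaBaxter.brace {B : GroupLieAlgebra I G → G} (hB : IsRotaBaxter I B) :
    Brace (GroupLieAlgebra I G) where
  mul x y := x + Ad I (B x) y
  one := 0
  inv x := -(Ad I (B x)⁻¹ x)
  mul_assoc x y z := by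
    change (x + Ad I (B x) y) + Ad I (B (x + Ad I (B x) y)) z
      = x + Ad I (B x) (y + Ad I (B y) z)
    rw [← hB x y, Ad_mul_apply, ContinuousLinearMap.map_add, add_assoc]
  one_mul x := by
    change 0 + Ad I (B 0) x = x
    rw [hB.map_zero, map_one, zero_add]
    rfl
  mul_one x := by
    change x + Ad I (B x) 0 = x
    rw [ContinuousLinearMap.map_zero, add_zero]
  inv_mul_cancel x := by
    change -(Ad I (B x)⁻¹ x) + Ad I (B (-(Ad I (B x)⁻¹ x))) x = 0
    rw [hB.map_inv, neg_add_cancel]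
  mul_add_eq x y z := by
    change x + Ad I (B x) (y + z) = (x + Ad I (B x) y) + (x + Ad I (B x) z) - x
    rw [ContinuousLinearMap.map_add]
    abel

end LieGroups

/-!
The analytic input is that in a connected Lie group an element `g` with `Ad g = 1` is central
(`mem_center_of_Ad_eq_one`). No exponential map is needed: the map `F(h) = g h g⁻¹ h⁻¹` has
differential `Ad g - 1 = 0` at `1`, and `F(h k) = (g h g⁻¹) F(k) h⁻¹` carries this to every point,
so `F` is locally constant (`isLocallyConstant_of_mfderiv_eq_zero`), hence constant with value `1`.

The rest is the algebra of central extensions. The gamma function of a brace is a homomorphism from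
`(𝔤, ∗)` to the automorphisms of `(𝔤, +)` (`Brace.gamma_op`), so a lift `C` of it to `G` is
multiplicative up to the kernel of `Ad`, that is, up to the center, and associativity makes the
defect `κ` a cocycle (`Brace.mem_cocycles₂`). Two lifts differ by a central function `l`
(`Brace.exists_center_of_lifts`), and replacing `C` by `C l⁻¹` replaces `κ` by `κ δ(l)⁻¹`
(`Brace.central_twist`). Finally, the Rota-Baxter operators that yield the brace are exactly the
lifts with trivial defect (`Brace.isRotaBaxter_of_lift`, `IsRotaBaxter.map_brace_op`). All claims
follow by comparing lifts; the last one is the comparison of two lifts with trivial defect, for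
which `δ(l) = 1` says that `l` is a homomorphism.
-/

/-! ### Maps with vanishing differential -/

section ZeroDerivative

variable {E : Type*} [NormedAddCommGroup E] [NormedSpace ℝ E]
  {H : Type*} [TopologicalSpace H] {I : ModelWithCorners ℝ E H} [I.Boundaryless]
  {M : Type*} [TopologicalSpace M] [ChartedSpace H M] [IsManifold I 1 M]
  {E' : Type*} [NormedAddCommGroup E'] [NormedSpace ℝ E']
  {H' : Type*} [TopologicalSpace H'] {J : ModelWithCorners ℝ E' H'}
  {N : Type*} [TopologicalSpace N] [ChartedSpace H' N] [IsManifold J 1 N]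

/-- A differentiable map between manifolds whose differential vanishes everywhere is locally
constant: in charts, this is the mean value inequality on a ball. -/
theorem isLocallyConstant_of_mfderiv_eq_zero {F : M → N} (hF : MDifferentiable I J F)
    (h0 : ∀ x, mfderiv I J F x = 0) : IsLocallyConstant F := by
  rw [IsLocallyConstant.iff_eventually_eq]
  intro x
  have hsrc : F ⁻¹' (extChartAt J (F x)).source ∈ nhds x :=
    (hF x).continuousAt.preimage_mem_nhds (extChartAt_source_mem_nhds (F x))
  have hU : (extChartAt I x).target ∩
      (extChartAt I x).symm ⁻¹' (F ⁻¹' (extChartAt J (F x)).source) ∈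
        nhds (extChartAt I x x) := by
    refine Filter.inter_mem (extChartAt_target_mem_nhds x) ?_
    exact (continuousAt_extChartAt_symm x).preimage_mem_nhds
      (by rwa [extChartAt_to_inv])
  obtain ⟨r, hr, hball⟩ := Metric.mem_nhds_iff.1 hU
  have hd : ∀ z ∈ Metric.ball (extChartAt I x x) r,
      HasFDerivAt (extChartAt J (F x) ∘ F ∘ (extChartAt I x).symm) (0 : E →L[ℝ] E') z := by
    intro z hz
    obtain ⟨hz1, hz2⟩ := hball hz
    have hs : MDifferentiableAt 𝓘(ℝ, E) I (extChartAt I x).symm z := by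
      have := mdifferentiableWithinAt_extChartAt_symm (I := I) hz1
      rwa [I.range_eq_univ, mdifferentiableWithinAt_univ] at this
    have hFz : HasMFDerivAt I J F ((extChartAt I x).symm z) 0 := by
      have := (hF ((extChartAt I x).symm z)).hasMFDerivAt
      rwa [h0] at this
    have he : MDifferentiableAt J 𝓘(ℝ, E') (extChartAt J (F x)) (F ((extChartAt I x).symm z)) :=
      mdifferentiableAt_extChartAt (by simpa using hz2)
    have hc := he.hasMFDerivAt.comp z (hFz.comp z hs.hasMFDerivAt)
    rw [ContinuousLinearMap.zero_comp, ContinuousLinearMap.comp_zero] at hc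
    exact hc.hasFDerivAt
  have hconst : ∀ z ∈ Metric.ball (extChartAt I x x) r,
      extChartAt J (F x) (F ((extChartAt I x).symm z)) = extChartAt J (F x) (F x) := by
    intro z hz
    have := (convex_ball (extChartAt I x x) r).isPreconnected
    have h := Metric.isOpen_ball.is_const_of_fderiv_eq_zero (𝕜 := ℝ) this
      (fun w hw => (hd w hw).differentiableAt.differentiableWithinAt)
      (fun w hw => (hd w hw).fderiv) hz (Metric.mem_ball_self hr)
    simpa using h
  filter_upwards [(continuousAt_extChartAt (I := I) x).preimage_mem_nhds
    (Metric.ball_mem_nhds _ hr), extChartAt_source_mem_nhds (I := I) x, hsrc] with y hy1 hy2 hy3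
  have h := hconst _ hy1
  rw [(extChartAt I x).left_inv hy2] at h
  exact (extChartAt J (F x)).injOn hy3 (mem_extChartAt_source (F x)) h

end ZeroDerivative

/-! ### The kernel of the adjoint representation -/

section KernelOfAd

variable {E : Type*} [NormedAddCommGroup E] [NormedSpace ℝ E] {H : Type*} [TopologicalSpace H]
  {I : ModelWithCorners ℝ E H} {G : Type*} [TopologicalSpace G] [ChartedSpace H G] [Group G]
  [LieGroup I ∞ G]

theorem contMDiff_commutator_left (g : G) :
    ContMDiff I I ∞ (fun h : G => g * h * g⁻¹ * h⁻¹) :=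
  ((contMDiff_const.mul contMDiff_id).mul contMDiff_const).mul (contMDiff_id.inv)

/-- If `Ad g = 1`, then the differential at `1` of `h ↦ g h g⁻¹ h⁻¹` is `Ad g - 1 = 0`: apply the
product rule to `(g h g⁻¹ h⁻¹) h = g h g⁻¹`. -/
theorem mfderiv_commutator_one {g : G} (hg : Ad I g = 1) :
    mfderiv I I (fun h : G => g * h * g⁻¹ * h⁻¹) 1 = 0 := by
  set F : G → G := fun h => g * h * g⁻¹ * h⁻¹ with hFdef
  have hF1 : F 1 = 1 := by simp [hFdef]
  have hF : MDifferentiableAt I I F 1 :=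
    (contMDiff_commutator_left (I := I) g).contMDiffAt.mdifferentiableAt (by simp)
  have hmul : MDifferentiableAt (I.prod I) I (fun p : G × G => p.1 * p.2) (F 1, 1) :=
    (contMDiff_mul I ∞).contMDiffAt.mdifferentiableAt (by simp)
  have hcomp := HasMFDerivAt.comp (f := fun h : G => (F h, id h)) (1 : G) hmul.hasMFDerivAt
    (hF.hasMFDerivAt.prodMk (mdifferentiableAt_id (I := I) (x := (1 : G))).hasMFDerivAt)
  have hconj : (fun p : G × G => p.1 * p.2) ∘ (fun h => (F h, id h)) =
      fun h : G => g * h * g⁻¹ := by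
    funext h; simp [hFdef]
  rw [hconj] at hcomp
  have hleft (w : E) : mfderiv I I (fun z : G => F 1 * z) 1 w = w := by
    rw [show (fun z : G => F 1 * z) = id by funext z; simp [hF1]]
    exact DFunLike.congr_fun mfderiv_id w
  have hright (w : E) : mfderiv I I (fun z : G => z * (1 : G)) (F 1) w = w := by
    rw [show (fun z : G => z * (1 : G)) = id by funext z; simp]
    exact DFunLike.congr_fun mfderiv_id w
  refine ContinuousLinearMap.ext fun (v : E) => ?_
  have hv : mfderiv I I (fun h : G => g * h * g⁻¹) 1 v = v := DFunLike.congr_fun hg v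
  rw [hcomp.mfderiv, mfderiv_id] at hv
  let w : E := mfderiv I I F 1 v
  have hsum := mfderiv_prod_eq_add_apply (v := ((w, v) : E × E)) hmul
  have hwv : v = w + v :=
    hv.symm.trans (hsum.trans (congrArg₂ (fun a b : E => a + b) (hright w) (hleft v)))
  exact right_eq_add.1 hwv

/-- The map `F(h) = g h g⁻¹ h⁻¹` satisfies `F(h k) = (g h g⁻¹) F(k) h⁻¹`, so that its differential
at `h` is determined by the one at `1`. -/
theorem mfderiv_commutator {g : G} (hg : Ad I g = 1) (h : G) :
    mfderiv I I (fun h : G => g * h * g⁻¹ * h⁻¹) h = 0 := by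
  set F : G → G := fun h => g * h * g⁻¹ * h⁻¹ with hFdef
  have hF : MDifferentiableAt I I F 1 :=
    (contMDiff_commutator_left (I := I) g).contMDiffAt.mdifferentiableAt (by simp)
  have hF0 : HasMFDerivAt I I F (h⁻¹ * h) 0 := by
    have := hF.hasMFDerivAt
    rw [mfderiv_commutator_one hg] at this
    rwa [inv_mul_cancel]
  have hl : MDifferentiableAt I I (fun k : G => h⁻¹ * k) h :=
    (contMDiff_mul_left (I := I) (n := ∞)).contMDiffAt.mdifferentiableAt (by simp)
  have ho : MDifferentiableAt I I (fun k : G => g * h * g⁻¹ * k * h⁻¹) (F (h⁻¹ * h)) :=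
    ((contMDiff_const.mul contMDiff_id).mul
      contMDiff_const : ContMDiff I I ∞ _).contMDiffAt.mdifferentiableAt (by simp)
  have hcomp : F = (fun k : G => g * h * g⁻¹ * k * h⁻¹) ∘ F ∘ fun k : G => h⁻¹ * k := by
    funext k; simp [hFdef, mul_assoc]
  have hc := ho.hasMFDerivAt.comp h (hF0.comp h hl.hasMFDerivAt)
  rw [ContinuousLinearMap.zero_comp, ContinuousLinearMap.comp_zero, ← hcomp] at hc
  exact hc.mfderiv

/-- In a connected Lie group, the kernel of the adjoint representation lies in the center. -/
theorem mem_center_of_Ad_eq_one [I.Boundaryless] [ConnectedSpace G] {g : G} (hg : Ad I g = 1) :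
    g ∈ Subgroup.center G := by
  have : IsManifold I 1 G := IsManifold.of_le (n := ∞) (by simp)
  have hloc := isLocallyConstant_of_mfderiv_eq_zero
    ((contMDiff_commutator_left (I := I) g).mdifferentiable (by simp)) (mfderiv_commutator hg)
  rw [Subgroup.mem_center_iff]
  intro h
  have := hloc.apply_eq_of_preconnectedSpace h 1
  simp only [mul_one, mul_inv_cancel, inv_one] at this
  rw [mul_inv_eq_one, mul_inv_eq_iff_eq_mul] at this
  exact this.symm

theorem Ad_eq_one_of_mem_center {g : G} (hg : g ∈ Subgroup.center G) : Ad I g = 1 := by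
  have h : (fun h : G => g * h * g⁻¹) = id := by
    funext h
    rw [← Subgroup.mem_center_iff.1 hg h, mul_inv_cancel_right, id]
  change adMap I g = 1
  unfold adMap
  rw [h]
  exact mfderiv_id

end KernelOfAd

/-! ### Classes of cocycles -/

section GroupCohomologyClasses

variable {Γ A : Type*} [Group Γ] [CommGroup A]

theorem trivClass_eq_of_mul_trivDelta {k k' : trivCocycles₂ Γ A} {l : Γ → A}
    (h : k.1 = k'.1 * trivDelta Γ A l) : trivClass k' = trivClass k := by
  refine QuotientGroup.eq.2 (Subgroup.mem_subgroupOf.2 ⟨l, ?_⟩)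
  rw [Subgroup.coe_mul, Subgroup.coe_inv, h, inv_mul_cancel_left]

theorem trivClass_eq_one_iff {k : trivCocycles₂ Γ A} :
    trivClass k = 1 ↔ ∃ l : Γ → A, k.1 = trivDelta Γ A l := by
  refine (QuotientGroup.eq_one_iff k).trans (Subgroup.mem_subgroupOf.trans ?_)
  exact exists_congr fun l => eq_comm

end GroupCohomologyClasses

/-! ### The gamma function of a brace -/

namespace Brace

variable {V : Type*} [AddCommGroup V]

theorem ext_op {b b' : Brace V} (h : ∀ x y, b.op x y = b'.op x y) : b = b' := by
  have hg : b.toGroup = b'.toGroup := Group.ext (by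
    ext x y
    exact h x y)
  cases b
  cases b'
  cases hg
  rfl

variable (b : Brace V)

theorem op_eq_add_gamma (x y : V) : b.op x y = x + b.gamma x y := by
  simp [gamma]

theorem op_assoc (x y z : V) : b.op (b.op x y) z = b.op x (b.op y z) :=
  b.toGroup.mul_assoc x y z

theorem gamma_add (x y z : V) : b.gamma x (y + z) = b.gamma x y + b.gamma x z := by
  have h : b.op x (y + z) = b.op x y + b.op x z - x := b.mul_add_eq x y z
  simp only [gamma, h]
  abel

theorem gamma_op (x y z : V) : b.gamma (b.op x y) z = b.gamma x (b.gamma y z) := by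
  have h := b.op_assoc x y z
  rw [op_eq_add_gamma b (b.op x y) z, op_eq_add_gamma b x (b.op y z), op_eq_add_gamma b y z,
    gamma_add, op_eq_add_gamma b x y, add_assoc] at h
  rw [op_eq_add_gamma b x y]
  exact add_left_cancel (add_left_cancel h)

end Brace

/-! ### Defects of maps that are multiplicative up to the center -/

section CentralTwist

variable {G : Type*} [Group G]

theorem Subgroup.commute_center (l : Subgroup.center G) (g : G) : Commute (l : G) g :=
  (Subgroup.mem_center_iff.1 l.2 g).symm

variable {V : Type*} [AddCommGroup V] (b : Brace V)

/-- The failure of `C` to be multiplicative changes by a coboundary when `C` is multiplied by a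
central function. -/
theorem Brace.central_twist (C : V → G) (l : V → Subgroup.center G) (x y : V) :
    C x * ((l x : G))⁻¹ * (C y * ((l y : G))⁻¹) * (C (b.op x y) * ((l (b.op x y) : G))⁻¹)⁻¹ =
      C x * C y * (C (b.op x y))⁻¹ * ((b.delta (Subgroup.center G) l x y : G))⁻¹ := by
  have hd : (b.delta (Subgroup.center G) l x y : G) =
      (l y : G) * ((l (b.op x y) : G))⁻¹ * (l x : G) := rfl
  have h1 := (Subgroup.commute_center (l x) (C y)).inv_left.eq
  have h2 := (Subgroup.commute_center (l (b.op x y)) (C (b.op x y))⁻¹).eq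
  have h3 := (Subgroup.commute_center (b.delta (Subgroup.center G) l x y)
    (C (b.op x y))).inv_left.inv_right.eq
  have h4 := (Subgroup.commute_center (l x) ((l y : G)⁻¹ * (l (b.op x y) : G))).inv_left.eq
  have h5 := (Subgroup.commute_center (l y) ((l (b.op x y) : G))).inv_left.eq
  calc _ = C x * (((l x : G))⁻¹ * C y) * ((l y : G))⁻¹ * ((l (b.op x y) : G) *
        (C (b.op x y))⁻¹) := by group
    _ = C x * C y * (((l x : G))⁻¹ * (((l y : G))⁻¹ * (l (b.op x y) : G))) *
        (C (b.op x y))⁻¹ := by rw [h1]; group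
    _ = C x * C y * ((b.delta (Subgroup.center G) l x y : G)⁻¹ * (C (b.op x y))⁻¹) := by
      rw [h5, hd]; group
    _ = _ := by rw [h3]; group

/-- If `C` is multiplicative up to central factors, these factors form a `2`-cocycle: compare the
two ways of writing `C(x) C(y) C(z)` as a central element times `C(x ∗ y ∗ z)`. -/
theorem Brace.mem_cocycles₂ {C : V → G} {k : V → V → Subgroup.center G}
    (hk : ∀ x y, (k x y : G) = C x * C y * (C (b.op x y))⁻¹) :
    k ∈ b.cocycles₂ (Subgroup.center G) := by
  have hC (x y : V) : C x * C y = k x y * C (b.op x y) := by rw [hk]; group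
  intro x y z
  change k y z * (k (b.op x y) z)⁻¹ * k x (b.op y z) * (k x y)⁻¹ = 1
  have h : (k x y * k (b.op x y) z : G) = k y z * k x (b.op y z) := by
    refine mul_right_cancel (b := C (b.op (b.op x y) z)) ?_
    calc (k x y * k (b.op x y) z : G) * C (b.op (b.op x y) z)
        = C x * C y * C z := by rw [hC x y, mul_assoc, mul_assoc, hC]
      _ = C x * k y z * C (b.op y z) := by rw [mul_assoc, hC y z, mul_assoc]
      _ = k y z * k x (b.op y z) * C (b.op (b.op x y) z) := by
        rw [← (Subgroup.commute_center (k y z) (C x)).eq, mul_assoc, hC x (b.op y z),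
          b.op_assoc, mul_assoc]
  have h' : k x y * k (b.op x y) z = k y z * k x (b.op y z) := Subtype.ext h
  rw [mul_right_comm (k y z), ← h', mul_inv_cancel_right, mul_inv_cancel]

end CentralTwist

/-! ### Rota-Baxter operators and lifts of the gamma function -/

section RotaBaxter

variable {E : Type*} [NormedAddCommGroup E] [NormedSpace ℝ E] {H : Type*} [TopologicalSpace H]
  {I : ModelWithCorners ℝ E H} {G : Type*} [TopologicalSpace G] [ChartedSpace H G] [Group G]
  [LieGroup I ∞ G] {b : Brace (GroupLieAlgebra I G)} {B C C' : GroupLieAlgebra I G → G}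

theorem IsRotaBaxter.brace_op (hB : IsRotaBaxter I B) (x y : GroupLieAlgebra I G) :
    hB.brace.op x y = x + Ad I (B x) y := rfl

theorem IsRotaBaxter.brace_gamma (hB : IsRotaBaxter I B) (x y : GroupLieAlgebra I G) :
    hB.brace.gamma x y = Ad I (B x) y := by
  rw [Brace.gamma, hB.brace_op, neg_add_cancel_left]

theorem IsRotaBaxter.map_brace_op (hB : IsRotaBaxter I B) (x y : GroupLieAlgebra I G) :
    B (hB.brace.op x y) = B x * B y :=
  (hB x y).symm

/-- A lift of the gamma function of a brace to `G` is a Rota-Baxter operator as soon as it is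
multiplicative on `(𝔤, ∗)`. -/
theorem Brace.isRotaBaxter_of_lift (hB : ∀ x y, b.gamma x y = Ad I (B x) y)
    (hmul : ∀ x y, B x * B y = B (b.op x y)) :
    ∃ hR : IsRotaBaxter I B, hR.brace = b := by
  have hop (x y : GroupLieAlgebra I G) : x + Ad I (B x) y = b.op x y := by
    rw [← hB, ← b.op_eq_add_gamma]
  have hR : IsRotaBaxter I B := fun x y => by rw [hop, hmul]
  exact ⟨hR, Brace.ext_op hop⟩

theorem Ad_mul_center_inv (g : G) (z : Subgroup.center G) :
    Ad I (g * ((z : G))⁻¹) = Ad I g := by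
  rw [map_mul, Ad_eq_one_of_mem_center (inv_mem z.2), mul_one]

variable [I.Boundaryless] [ConnectedSpace G]

/-- Two lifts of the same gamma function differ by a central function. -/
theorem Brace.exists_center_of_lifts (hC : ∀ x y, b.gamma x y = Ad I (C x) y)
    (hC' : ∀ x y, b.gamma x y = Ad I (C' x) y) :
    ∃ l : GroupLieAlgebra I G → Subgroup.center G, ∀ x, C' x = C x * ((l x : G))⁻¹ := by
  refine ⟨fun x => ⟨(C' x)⁻¹ * C x, mem_center_of_Ad_eq_one (I := I) ?_⟩, fun x => by simp⟩
  ext y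
  rw [Ad_mul_apply, ← hC, hC', Ad_inv_apply]
  rfl

theorem Brace.lift_mul_mem_center (hC : ∀ x y, b.gamma x y = Ad I (C x) y)
    (x y : GroupLieAlgebra I G) : C x * C y * (C (b.op x y))⁻¹ ∈ Subgroup.center G := by
  refine mem_center_of_Ad_eq_one (I := I) ?_
  ext z
  rw [Ad_mul_apply, Ad_mul_apply, ← hC, ← hC, ← b.gamma_op, hC, Ad_apply_inv]
  rfl

end RotaBaxter

/-! ### Braces and Rota-Baxter operators -/

theorem mainTheorem1
    {E : Type*} [NormedAddCommGroup E] [NormedSpace ℝ E] [FiniteDimensional ℝ E]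
    {H : Type*} [TopologicalSpace H] (I : ModelWithCorners ℝ E H) [I.Boundaryless]
    {G : Type*} [TopologicalSpace G] [ChartedSpace H G] [Group G] [LieGroup I ∞ G]
    [ConnectedSpace G]
    (b : Brace (GroupLieAlgebra I G))
    (C : GroupLieAlgebra I G → G)
    (hC : ∀ x y, b.gamma x y = Ad I (C x) y) :
    -- `κ(x, y) = C(x) C(y) C(x ∗ y)⁻¹` takes values in `Z(G)` and is a 2-cocycle of `(𝔤, ∗)`
    (∃ κ : b.cocycles₂ (Subgroup.center G),
      (∀ x y, ((κ.1 x y : Subgroup.center G) : G) = C x * C y * (C (b.op x y))⁻¹) ∧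
      -- its class does not depend on the choice of `C`
      (∀ (C' : GroupLieAlgebra I G → G) (κ' : b.cocycles₂ (Subgroup.center G)),
        (∀ x y, b.gamma x y = Ad I (C' x) y) →
        (∀ x y, ((κ'.1 x y : Subgroup.center G) : G) = C' x * C' y * (C' (b.op x y))⁻¹) →
        b.cohomologyClass κ' = b.cohomologyClass κ) ∧
      -- the brace comes from a Rota-Baxter operator iff the class of `κ` is trivial
      ((∃ (B : GroupLieAlgebra I G → G) (hB : IsRotaBaxter I B), hB.brace = b) ↔
        b.cohomologyClass κ = 1) ∧
      -- if `κ = δ(l)` then `B = C l⁻¹` is a Rota-Baxter operator that yields the brace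
      (∀ l : GroupLieAlgebra I G → Subgroup.center G,
        κ.1 = b.delta (Subgroup.center G) l →
        ∃ hB : IsRotaBaxter I (fun x => C x * ((l x : G))⁻¹), hB.brace = b) ∧
      -- and every Rota-Baxter operator that yields the brace is of this form
      (∀ (B : GroupLieAlgebra I G → G) (hB : IsRotaBaxter I B), hB.brace = b →
        ∃ l : GroupLieAlgebra I G → Subgroup.center G,
          κ.1 = b.delta (Subgroup.center G) l ∧
          ∀ x, B x = C x * ((l x : G))⁻¹) ∧
      -- the brace comes from a smooth Rota-Baxter operator iff `κ = δ(l)` with `C l⁻¹` smooth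
      ((∃ (B : GroupLieAlgebra I G → G) (hB : IsRotaBaxter I B),
          IsSmoothOnLieAlgebra I B ∧ hB.brace = b) ↔
        ∃ l : GroupLieAlgebra I G → Subgroup.center G,
          κ.1 = b.delta (Subgroup.center G) l ∧
          IsSmoothOnLieAlgebra I (fun x => C x * ((l x : G))⁻¹))) ∧
    -- two Rota-Baxter operators yield the same brace iff they differ by a homomorphism to `Z(G)`
    (∀ (B B' : GroupLieAlgebra I G → G) (hB : IsRotaBaxter I B) (hB' : IsRotaBaxter I B'),
      hB.brace = hB'.brace ↔
        ∃ ξ : GroupLieAlgebra I G → Subgroup.center G,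
          (∀ x y, ξ (hB'.brace.op x y) = ξ x * ξ y) ∧ ∀ x, B x = B' x * (ξ x : G)) := by
  -- The multiplicativity defects of a map `D` and of its central twist `D l⁻¹` differ by `δ(l)`.
  have twist (b : Brace (GroupLieAlgebra I G)) {D B : GroupLieAlgebra I G → G}
      {k k' l} (hk : ∀ x y, ((k x y : Subgroup.center G) : G) = D x * D y * (D (b.op x y))⁻¹)
      (hk' : ∀ x y, ((k' x y : Subgroup.center G) : G) = B x * B y * (B (b.op x y))⁻¹)
      (hB : ∀ x, B x = D x * ((l x : Subgroup.center G) : G)⁻¹) :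
      k = k' * b.delta (Subgroup.center G) l := by
    funext x y
    refine Subtype.ext ?_
    have h := b.central_twist D l x y
    rw [← hB, ← hB, ← hB, ← hk, ← hk'] at h
    change (k x y : G) = k' x y * (b.delta (Subgroup.center G) l x y : G)
    rw [h, inv_mul_cancel_right]
  have trivial_defect {B : GroupLieAlgebra I G → G} (hB : IsRotaBaxter I B) (x y) :
      (((1 : GroupLieAlgebra I G → GroupLieAlgebra I G → Subgroup.center G) x y :
        Subgroup.center G) : G) = B x * B y * (B (hB.brace.op x y))⁻¹ := by
    rw [hB.map_brace_op, mul_inv_cancel]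
    rfl
  refine ⟨?_, ?_⟩
  · let k : GroupLieAlgebra I G → GroupLieAlgebra I G → Subgroup.center G :=
      fun x y => ⟨C x * C y * (C (b.op x y))⁻¹, Brace.lift_mul_mem_center hC x y⟩
    have hk (x y) : (k x y : G) = C x * C y * (C (b.op x y))⁻¹ := rfl
    have of_delta (l : GroupLieAlgebra I G → Subgroup.center G)
        (hl : k = b.delta (Subgroup.center G) l) :
        ∃ hB : IsRotaBaxter I (fun x => C x * ((l x : G))⁻¹), hB.brace = b := by
      refine Brace.isRotaBaxter_of_lift (fun x y => by rw [hC, Ad_mul_center_inv]) fun x y => ?_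
      rw [← mul_inv_eq_one, b.central_twist C l x y, ← hk, hl, mul_inv_cancel]
    have to_delta (B : GroupLieAlgebra I G → G) (hB : IsRotaBaxter I B) (hb : hB.brace = b) :
        ∃ l : GroupLieAlgebra I G → Subgroup.center G,
          k = b.delta (Subgroup.center G) l ∧ ∀ x, B x = C x * ((l x : G))⁻¹ := by
      subst hb
      obtain ⟨l, hl⟩ := Brace.exists_center_of_lifts hC hB.brace_gamma
      exact ⟨l, (twist _ hk (trivial_defect hB) hl).trans (one_mul _), hl⟩
    refine ⟨⟨k, b.mem_cocycles₂ hk⟩, hk, ?_, ?_, of_delta, to_delta, ?_⟩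
    · intro C' κ' hC' hκ'
      obtain ⟨l, hl⟩ := Brace.exists_center_of_lifts hC hC'
      exact @trivClass_eq_of_mul_trivDelta _ _ b.toGroup _ _ _ l (twist b hk hκ' hl)
    · refine Iff.trans ?_ (@trivClass_eq_one_iff _ _ b.toGroup _ _).symm
      constructor
      · rintro ⟨B, hB, hb⟩
        obtain ⟨l, hl, -⟩ := to_delta B hB hb
        exact ⟨l, hl⟩
      · rintro ⟨l, hl⟩
        exact ⟨_, of_delta l hl⟩
    · constructor
      · rintro ⟨B, hB, hs, hb⟩
        obtain ⟨l, hl, hBl⟩ := to_delta B hB hb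
        exact ⟨l, hl, funext hBl ▸ hs⟩
      · rintro ⟨l, hl, hs⟩
        obtain ⟨hB, hb⟩ := of_delta l hl
        exact ⟨_, hB, hs, hb⟩
  · intro B B' hB hB'
    constructor
    · intro hb
      obtain ⟨l, hl⟩ := Brace.exists_center_of_lifts (b := hB'.brace) hB'.brace_gamma
        (C' := B) (hb ▸ hB.brace_gamma)
      -- Both defects are trivial, so `δ(l) = 1`, which says that `l` is a homomorphism.
      have hd := twist hB'.brace (trivial_defect hB') (hb ▸ trivial_defect hB) hl
      rw [one_mul] at hd
      refine ⟨l⁻¹, fun x y => ?_, hl⟩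
      have hxy : 1 = l y * (l (hB'.brace.op x y))⁻¹ * l x := congrFun (congrFun hd x) y
      rw [mul_right_comm, eq_mul_inv_iff_mul_eq, one_mul] at hxy
      rw [Pi.inv_apply, Pi.inv_apply, Pi.inv_apply, hxy, mul_inv_rev]
    · rintro ⟨ξ, -, hξ⟩
      refine Brace.ext_op fun x y => ?_
      have h := Ad_mul_center_inv (I := I) (B' x) (ξ x)⁻¹
      rw [Subgroup.coe_inv, inv_inv, ← hξ] at h
      rw [hB.brace_op, hB'.brace_op, h]
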